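/- Let $A,B,C$ be disjoint finite sets. A hypergraph is a set $H\subseteq A\times B\times C$ of hyperedges (a partite $3$-uniform hypergraph), and $\mathcal H$ is the set of all hypergraphs. The degree $d_H(v)$ of a vertex $v$ is the number of hyperedges of $H$ containing $v$. Let $d(v)\in\mathbb Z_{\ge 0}$ be prescribed degrees, for $v\in A\cup B\cup C$, and put $\Delta G(H)=\sum_{v\in A\cup B\cup C}|d(v)-d_H(v)|$. For $T>0$ let $\pi_T$ be the Boltzmann distribution on $\mathcal H$, $\pi_T(H)=\frac1Z e^{-\Delta G(H)/T}$ with $Z=\sum_{H\in\mathcal H}e^{-\Delta G(H)/T}$. A step of the Markov chain $M_T$ on $\mathcal H$ from $H$ is as follows. First a hypergraph $H'$ is proposed by one of three operations, each chosen with probability $\frac13$: 1. Switch: choose $e_1,e_2\in H$ independently and uniformly, and a vertex class $X\in\{A,B,C\}$ uniformly. Let $e_1',e_2'$ be obtained from $e_1,e_2$ by exchanging their vertices in $X$. If $e_1',e_2'\notin H$, then $H'=(H\cup\{e_1',e_2'\})\setminus\{e_1,e_2\}$. 2. Hinge-flip: choose $e\in H$, a class $X\in\{A,B,C\}$, and then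 a vertex $x\in X$, $x\notin e$, each uniformly. Let $e'$ be $e$ with its vertex in $X$ replaced by $x$. If $e'\notin H$, then $H'=(H\cup\{e'\})\setminus\{e\}$. 3. Toggle: choose $e\in A\times B\times C$ uniformly; $H'=H\setminus\{e\}$ if $e\in H$, and $H'=H\cup\{e\}$ otherwise. If the operation is not allowed, or a required choice is from an empty set, then $H'=H$. The next state is $H'$ if $u\le e^{-\Delta G(H')/T}/e^{-\Delta G(H)/T}$ for a random $u$ uniform on $[0,1]$, and $H$ otherwise. Let $k\ge1$ and $0<T_1<\dots<T_k$. The Parallel Tempering chain $\mathcal M$ on $\mathcal H^k$ makes the following step from $(H_1,\dots,H_k)$. With probability $\frac12$, choose $i\in\{1,\dots,k\}$ uniformly and make a step of $M_{T_i}$ in the $i$-th coordinate. With probability $\frac12$, choose $i\in\{1,\dots,k-1\}$ uniformly (if $k=1$, do nothing), draw $u$ uniformly from $[0,1]$, and exchange $H_i$ and $H_{i+1}$ if $$u\le\frac{e^{-\Delta G(H_i)/T_{i+1}}\,e^{-\Delta G(H_{i+1})/T_i}}{e^{-\Delta G(H_i)/T_i}\,e^{-\Delta G(H_{i+1})/T_{i+1}}};$$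 otherwise do nothing. **Theorem.** The chain $\mathcal M$ converges to $\pi_{T_1}\times\pi_{T_2}\times\dots\times\pi_{T_k}$: for every initial distribution on $\mathcal H^k$, the law of the state after $t$ steps converges to $\pi_{T_1}\times\dots\times\pi_{T_k}$ in total variation distance as $t\to\infty$. In this limit distribution the coordinates are independent, and the $i$-th coordinate has the distribution $\pi_{T_i}$. -/

import Mathlib

open MeasureTheory ProbabilityTheory Filter Topology

/-- A hyperedge of a partite 3-uniform hypergraph: exactly one vertex from each of the three
disjoint vertex classes `A`, `B`, `C`. -/
abbrev Hyperedge (A B C : Type*) := A × B × C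

/-- A partite 3-uniform hypergraph on the vertex classes `A`, `B`, `C`, given by its
set of hyperedges. -/
abbrev PartiteHypergraph (A B C : Type*) := Finset (Hyperedge A B C)

/-- A prescribed degree sequence `D = (D_A, D_B, D_C)` (not assumed to have a realization). -/
structure DegreeSequence (A B C : Type*) where
  dA : A → ℕ
  dB : B → ℕ
  dC : C → ℕ

section Energy

variable {A B C : Type*} [DecidableEq A] [DecidableEq B] [DecidableEq C]

/-- The degree of a vertex `a ∈ A`: the number of hyperedges incident with it. -/
def degA (H : PartiteHypergraph A B C) (a : A) : ℕ := (H.filter fun e => e.1 = a).card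

/-- The degree of a vertex `b ∈ B`. -/
def degB (H : PartiteHypergraph A B C) (b : B) : ℕ := (H.filter fun e => e.2.1 = b).card

/-- The degree of a vertex `c ∈ C`. -/
def degC (H : PartiteHypergraph A B C) (c : C) : ℕ := (H.filter fun e => e.2.2 = c).card

variable [Fintype A] [Fintype B] [Fintype C]

/-- The energy `ΔG(H)`: the `L¹` deviation of the degrees of `H` from the prescribed ones. -/
noncomputable def energy (D : DegreeSequence A B C) (H : PartiteHypergraph A B C) : ℝ :=
  ∑ a, |(D.dA a : ℝ) - degA H a| + ∑ b, |(D.dB b : ℝ) - degB H b|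
    + ∑ c, |(D.dC c : ℝ) - degC H c|

/-- The Boltzmann weight `exp (-ΔG(H) / T)`. -/
noncomputable def boltzmannWeight (D : DegreeSequence A B C) (T : ℝ) (H : PartiteHypergraph A B C) : ℝ :=
  Real.exp (-energy D H / T)

/-- The partition function `Z`. -/
noncomputable def partitionFunction (D : DegreeSequence A B C) (T : ℝ) : ℝ :=
  ∑ H : PartiteHypergraph A B C, boltzmannWeight D T H

theorem boltzmannWeight_pos (D : DegreeSequence A B C) (T : ℝ) (H : PartiteHypergraph A B C) :
    0 < boltzmannWeight D T H := Real.exp_pos _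

theorem partitionFunction_pos (D : DegreeSequence A B C) (T : ℝ) :
    0 < partitionFunction D T :=
  Finset.sum_pos (fun H _ => boltzmannWeight_pos D T H) Finset.univ_nonempty

/-- The Boltzmann distribution `π_T(H) = exp (-ΔG(H) / T) / Z` on the set of all hypergraphs. -/
noncomputable def boltzmann (D : DegreeSequence A B C) (T : ℝ) : PMF (PartiteHypergraph A B C) :=
  PMF.ofFintype (fun H => ENNReal.ofReal (boltzmannWeight D T H / partitionFunction D T)) (by
    rw [← ENNReal.ofReal_sum_of_nonneg
      (fun H _ => div_nonneg (boltzmannWeight_pos D T H).le (partitionFunction_pos D T).le),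
      ← Finset.sum_div]
    exact (congrArg ENNReal.ofReal (div_self (partitionFunction_pos D T).ne')).trans
      ENNReal.ofReal_one)

/-- The product distribution `π_{T_1} × ⋯ × π_{T_k}` on tuples of hypergraphs. -/
noncomputable def boltzmannProduct {k : ℕ} (D : DegreeSequence A B C) (T : Fin k → ℝ) :
    PMF (Fin k → PartiteHypergraph A B C) :=
  PMF.ofFintype (fun s => ∏ i, boltzmann D (T i) (s i)) (by
    rw [← Fintype.prod_sum]
    refine Finset.prod_eq_one fun i _ => ?_
    exact (tsum_fintype _).symm.trans (boltzmann D (T i)).tsum_coe)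

end Energy

section Random

/-- Draw `x` uniformly from the finite set `s` and continue with `f x`; if there is nothing to
choose from, the outcome is `y`. -/
noncomputable def drawOr {α β : Type*} (s : Finset α) (y : β) (f : α → PMF β) : PMF β :=
  open Classical in
  if h : s.Nonempty then (PMF.uniformOfFinset s h).bind f else PMF.pure y

/-- The uniform distribution on the interval `[0, 1]`. -/
noncomputable def uniformUnitInterval : Measure ℝ := volume.restrict (Set.Icc 0 1)

/-- The probability that `u ≤ r` for a random number `u` uniform on `[0, 1]`. -/
noncomputable def acceptProb (r : ℝ) : ENNReal := uniformUnitInterval (Set.Iic r)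

theorem acceptProb_le_one (r : ℝ) : acceptProb r ≤ 1 := by
  unfold acceptProb uniformUnitInterval
  refine (measure_mono (Set.subset_univ _)).trans ?_
  simp

/-- Draw `u` uniformly from `[0, 1]`; the outcome is `x` if `u ≤ r`, and `y` otherwise. -/
noncomputable def acceptOr {β : Type*} (r : ℝ) (x y : β) : PMF β :=
  (PMF.ofFintype (fun b : Bool => if b then acceptProb r else 1 - acceptProb r) (by
    simpa using add_tsub_cancel_of_le (acceptProb_le_one r))).map fun b => if b then x else y

/-- The total variation distance of two distributions on a finite set. -/
noncomputable def tvDist {α : Type*} [Fintype α] (μ ν : PMF α) : ℝ :=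
  (1 / 2) * ∑ x, |(μ x).toReal - (ν x).toReal|

end Random

section Chain

variable {A B C : Type*} [DecidableEq A] [DecidableEq B] [DecidableEq C]

/-- The names of the three vertex classes. -/
inductive VertexClass
  | A | B | C
  deriving DecidableEq

instance VertexClass.instFintype : Fintype VertexClass where
  elems := {.A, .B, .C}
  complete := by rintro (_ | _ | _) <;> decide

/-- The hyperedge obtained from `e` by replacing its vertex in the class `X` by that of `e'`. -/
def replaceVertex (X : VertexClass) (e e' : Hyperedge A B C) : Hyperedge A B C :=
  match X with
  | .A => (e'.1, e.2.1, e.2.2)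
  | .B => (e.1, e'.2.1, e.2.2)
  | .C => (e.1, e.2.1, e'.2.2)

/-- The outcome of a switch at `e₁`, `e₂` and the class `X`, which exchanges the vertices of
`e₁` and `e₂` in `X`; nothing happens if one of the new hyperedges is already present. -/
def switchAt (H : PartiteHypergraph A B C) (e₁ e₂ : Hyperedge A B C) (X : VertexClass) :
    PartiteHypergraph A B C :=
  if replaceVertex X e₁ e₂ ∉ H ∧ replaceVertex X e₂ e₁ ∉ H then
    (H ∪ {replaceVertex X e₁ e₂, replaceVertex X e₂ e₁}) \ {e₁, e₂}
  else H

/-- The outcome of a hinge-flip that replaces the hyperedge `e` by `e'`; nothing happens if `e'`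
is already present. -/
def hingeFlipAt (H : PartiteHypergraph A B C) (e e' : Hyperedge A B C) : PartiteHypergraph A B C :=
  if e' ∉ H then (H ∪ {e'}) \ {e} else H

/-- Toggle the hyperedge `e` out if it is present, and in if it is not. -/
def toggleAt (H : PartiteHypergraph A B C) (e : Hyperedge A B C) : PartiteHypergraph A B C :=
  if e ∈ H then H \ {e} else H ∪ {e}

/-- The switch proposal: two hyperedges chosen independently and uniformly, and a uniform
vertex class. -/
noncomputable def switchProposal (H : PartiteHypergraph A B C) : PMF (PartiteHypergraph A B C) :=
  drawOr H H fun e₁ => drawOr H H fun e₂ => drawOr (Finset.univ : Finset VertexClass) H fun X =>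
    PMF.pure (switchAt H e₁ e₂ X)

variable [Fintype A] [Fintype B] [Fintype C]

/-- The hinge-flip proposal: a uniform hyperedge `e`, a uniform vertex class `X`, and a uniform
vertex `x` of that class with `x ∉ e`. -/
noncomputable def hingeFlipProposal (H : PartiteHypergraph A B C) : PMF (PartiteHypergraph A B C) :=
  drawOr H H fun e => drawOr (Finset.univ : Finset VertexClass) H fun X =>
    match X with
    | .A => drawOr (Finset.univ.filter fun x : A => x ≠ e.1) H fun x =>
        PMF.pure (hingeFlipAt H e (x, e.2.1, e.2.2))
    | .B => drawOr (Finset.univ.filter fun x : B => x ≠ e.2.1) H fun x =>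
        PMF.pure (hingeFlipAt H e (e.1, x, e.2.2))
    | .C => drawOr (Finset.univ.filter fun x : C => x ≠ e.2.2) H fun x =>
        PMF.pure (hingeFlipAt H e (e.1, e.2.1, x))

/-- The toggle proposal: a uniform triple of vertices, one of each class. -/
noncomputable def toggleProposal (H : PartiteHypergraph A B C) : PMF (PartiteHypergraph A B C) :=
  drawOr (Finset.univ : Finset (Hyperedge A B C)) H fun e => PMF.pure (toggleAt H e)

/-- The proposal of the chains: switch, hinge-flip or toggle, each with probability `1/3`. -/
noncomputable def proposal (H : PartiteHypergraph A B C) : PMF (PartiteHypergraph A B C) :=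
  (PMF.uniformOfFintype (Fin 3)).bind fun j =>
    match j with
    | 0 => switchProposal H
    | 1 => hingeFlipProposal H
    | 2 => toggleProposal H

/-- One step of the Metropolis-Hastings chain `M_T` from the state `H`. -/
noncomputable def metropolisStep (D : DegreeSequence A B C) (T : ℝ) (H : PartiteHypergraph A B C) :
    PMF (PartiteHypergraph A B C) :=
  (proposal H).bind fun H' => acceptOr (boltzmannWeight D T H' / boltzmannWeight D T H) H' H

/-- The swap proposal's ratio for two states `H`, `H'` at the temperatures `T`, `T'`. -/
noncomputable def swapRatio (D : DegreeSequence A B C) (T T' : ℝ) (H H' : PartiteHypergraph A B C) : ℝ :=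
  (boltzmannWeight D T' H * boltzmannWeight D T H') /
    (boltzmannWeight D T H * boltzmannWeight D T' H')

/-- One step of the Parallel Tempering chain on `k = n + 1` hypergraphs at the temperatures
`T 0, …, T n`. With probability `1/2` a uniformly chosen coordinate makes a Metropolis-Hastings
step, and with probability `1/2` a swap of the states of a uniformly chosen pair of
neighbouring coordinates `i`, `i + 1` is attempted (if there is such a pair). -/
noncomputable def parallelTemperingStep {n : ℕ} (D : DegreeSequence A B C)
    (T : Fin (n + 1) → ℝ) (s : Fin (n + 1) → PartiteHypergraph A B C) :
    PMF (Fin (n + 1) → PartiteHypergraph A B C) :=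
  (PMF.uniformOfFintype Bool).bind fun b =>
    if b then
      drawOr (Finset.univ : Finset (Fin (n + 1))) s fun i =>
        (metropolisStep D (T i) (s i)).map fun H => Function.update s i H
    else
      drawOr (Finset.univ : Finset (Fin n)) s fun i =>
        acceptOr (swapRatio D (T i.castSucc) (T i.succ) (s i.castSucc) (s i.succ))
          (s ∘ Equiv.swap i.castSucc i.succ) s

/-- The law of the Parallel Tempering chain after `t` steps, for the initial distribution `μ`. -/
noncomputable def parallelTemperingLaw {n : ℕ} (D : DegreeSequence A B C)
    (T : Fin (n + 1) → ℝ) (μ : PMF (Fin (n + 1) → PartiteHypergraph A B C)) (t : ℕ) :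
    PMF (Fin (n + 1) → PartiteHypergraph A B C) :=
  (fun ν => ν.bind (parallelTemperingStep D T))^[t] μ

end Chain

/-!
All three proposals are symmetric: the reverse of a switch, a hinge-flip or a toggle is a move of
the same kind, and it is drawn with the same probability because a switch and a hinge-flip preserve
the number of hyperedges. Hence the Metropolis step at temperature `T` satisfies detailed balance
with respect to `π_T`. Exchanging two coordinates is an involution, so the swap step is a Metropolis
step for the product distribution. Detailed balance survives mixing and acting on one coordinate,
so `π_{T_1} × ⋯ × π_{T_k}` is stationary.

Toggling out one hyperedge after another leads from any state to the tuple of empty hypergraphs,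
and a swap attempt at this tuple changes nothing. So at some common time the chain is at this tuple
with positive probability from every initial state, and by Doeblin's argument the total variation
distance to the stationary distribution tends to zero.
-/

section FiniteChain

variable {α : Type*}

/-- The law after `t` steps of the Markov chain with transition kernel `K` and initial
distribution `μ`. -/
noncomputable def chainLaw (K : α → PMF α) (μ : PMF α) (t : ℕ) : PMF α :=
  (fun ν => ν.bind K)^[t] μ

theorem chainLaw_succ (K : α → PMF α) (μ : PMF α) (t : ℕ) :
    chainLaw K μ (t + 1) = (chainLaw K μ t).bind K :=
  Function.iterate_succ_apply' _ _ _

theorem chainLaw_add (K : α → PMF α) (μ : PMF α) (s t : ℕ) :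
    chainLaw K μ (s + t) = (chainLaw K μ s).bind fun x => chainLaw K (PMF.pure x) t := by
  induction t with
  | zero => exact (PMF.bind_pure _).symm
  | succ t ih => simp only [← add_assoc, chainLaw_succ, ih, PMF.bind_bind]

theorem chainLaw_pure_succ (K : α → PMF α) (x : α) (t : ℕ) :
    chainLaw K (PMF.pure x) (t + 1) = (K x).bind fun y => chainLaw K (PMF.pure y) t := by
  rw [add_comm, chainLaw_add, chainLaw_succ, chainLaw, Function.iterate_zero_apply, PMF.pure_bind]

theorem chainLaw_of_bind_eq {K : α → PMF α} {π : PMF α} (hπ : π.bind K = π) (t : ℕ) :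
    chainLaw K π t = π :=
  Function.iterate_fixed hπ t

theorem mem_support_chainLaw_self {K : α → PMF α} {x : α} (hx : x ∈ (K x).support) (t : ℕ) :
    x ∈ (chainLaw K (PMF.pure x) t).support := by
  induction t with
  | zero => exact (PMF.mem_support_pure_iff _ _).mpr rfl
  | succ t ih =>
    rw [chainLaw_succ, PMF.mem_support_bind_iff]
    exact ⟨x, ih, hx⟩

theorem eventually_mem_support_chainLaw {K : α → PMF α} {x y : α} (hy : y ∈ (K y).support)
    (hxy : Relation.ReflTransGen (fun x y => y ∈ (K x).support) x y) :
    ∀ᶠ t in atTop, y ∈ (chainLaw K (PMF.pure x) t).support := by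
  induction hxy using Relation.ReflTransGen.head_induction_on with
  | refl => exact Eventually.of_forall (mem_support_chainLaw_self hy)
  | head hxz _ ih =>
    obtain ⟨N, hN⟩ := eventually_atTop.mp ih
    refine eventually_atTop.mpr ⟨N + 1, fun t ht => ?_⟩
    obtain ⟨t, rfl⟩ := Nat.exists_eq_add_of_le' (Nat.le_of_add_left_le ht)
    rw [chainLaw_pure_succ, PMF.mem_support_bind_iff]
    exact ⟨_, hxz, hN t (Nat.le_of_add_le_add_right ht)⟩

variable [Fintype α]

theorem sum_toReal_apply (μ : PMF α) : ∑ x, (μ x).toReal = 1 := by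
  rw [← ENNReal.toReal_sum fun x _ => μ.apply_ne_top x, ← tsum_fintype (L := .unconditional α),
    μ.tsum_coe, ENNReal.toReal_one]

theorem toReal_bind_apply (μ : PMF α) (L : α → PMF α) (y : α) :
    (μ.bind L y).toReal = ∑ x, (μ x).toReal * (L x y).toReal := by
  rw [PMF.bind_apply, tsum_fintype, ENNReal.toReal_sum fun x _ =>
    ENNReal.mul_ne_top (μ.apply_ne_top x) ((L x).apply_ne_top y)]
  simp only [ENNReal.toReal_mul]

theorem tvDist_nonneg (μ ν : PMF α) : 0 ≤ tvDist μ ν :=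
  mul_nonneg (by norm_num) (Finset.sum_nonneg fun _ _ => abs_nonneg _)

/- Doeblin's contraction: the part `ρ` common to all the `L x` cancels in the difference of the
two laws, since `μ` and `ν` have the same mass. -/
theorem tvDist_bind_le (L : α → PMF α) {ρ : α → ℝ} (hρ : ∀ x y, ρ y ≤ (L x y).toReal)
    (μ ν : PMF α) : tvDist (μ.bind L) (ν.bind L) ≤ (1 - ∑ y, ρ y) * tvDist μ ν := by
  set δ : α → ℝ := fun x => (μ x).toReal - (ν x).toReal
  have sum_δ : ∑ x, δ x = 0 := by
    rw [Finset.sum_sub_distrib, sum_toReal_apply, sum_toReal_apply, sub_self]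
  have bind_sub_bind : ∀ y, (μ.bind L y).toReal - (ν.bind L y).toReal =
      ∑ x, δ x * ((L x y).toReal - ρ y) := fun y => by
    simp only [mul_sub, Finset.sum_sub_distrib, ← Finset.sum_mul, sum_δ, zero_mul, sub_zero]
    simp only [δ, sub_mul, Finset.sum_sub_distrib, toReal_bind_apply]
  have sum_abs_le : ∑ y, |(μ.bind L y).toReal - (ν.bind L y).toReal| ≤
      (1 - ∑ y, ρ y) * ∑ x, |δ x| :=
    calc ∑ y, |(μ.bind L y).toReal - (ν.bind L y).toReal|
        ≤ ∑ y, ∑ x, |δ x| * ((L x y).toReal - ρ y) := by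
          refine Finset.sum_le_sum fun y _ => ?_
          rw [bind_sub_bind]
          refine (Finset.abs_sum_le_sum_abs _ _).trans_eq (Finset.sum_congr rfl fun x _ => ?_)
          rw [abs_mul, abs_of_nonneg (sub_nonneg.mpr (hρ x y))]
      _ = ∑ x, |δ x| * ∑ y, ((L x y).toReal - ρ y) := by
          rw [Finset.sum_comm]
          simp only [Finset.mul_sum]
      _ = (1 - ∑ y, ρ y) * ∑ x, |δ x| := by
          simp only [Finset.sum_sub_distrib, sum_toReal_apply, ← Finset.sum_mul]
          rw [mul_comm]
  rw [tvDist, tvDist, mul_left_comm]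
  gcongr

theorem tvDist_bind_le_tvDist (L : α → PMF α) (μ ν : PMF α) :
    tvDist (μ.bind L) (ν.bind L) ≤ tvDist μ ν := by
  simpa using tvDist_bind_le L (ρ := 0) (fun _ _ => ENNReal.toReal_nonneg) μ ν

theorem exists_lt_one_tvDist_bind_le (L : α → PMF α) {x₀ : α} (hL : ∀ x, x₀ ∈ (L x).support) :
    ∃ r < 1, ∀ μ ν : PMF α, tvDist (μ.bind L) (ν.bind L) ≤ r * tvDist μ ν := by
  have : Nonempty α := ⟨x₀⟩
  set ρ : α → ℝ := fun y => ⨅ x, (L x y).toReal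
  have ρ_nonneg : ∀ y, 0 ≤ ρ y := fun y => le_ciInf fun _ => ENNReal.toReal_nonneg
  have ρ_pos : 0 < ρ x₀ := by
    obtain ⟨x, hx⟩ := exists_eq_ciInf_of_finite (f := fun x => (L x x₀).toReal)
    exact (ENNReal.toReal_pos (hL x) ((L x).apply_ne_top x₀)).trans_eq hx
  have sum_ρ_pos : 0 < ∑ y, ρ y :=
    Finset.sum_pos' (fun y _ => ρ_nonneg y) ⟨x₀, Finset.mem_univ x₀, ρ_pos⟩
  exact ⟨1 - ∑ y, ρ y, sub_lt_self 1 sum_ρ_pos,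
    tvDist_bind_le L fun x y => ciInf_le (Set.finite_range _).bddBelow x⟩

theorem tendsto_zero_of_antitone_of_add_le_mul {a : ℕ → ℝ} (hanti : Antitone a)
    (hnonneg : ∀ t, 0 ≤ a t) {r : ℝ} (hr : r < 1) {N : ℕ} (h : ∀ t, a (t + N) ≤ r * a t) :
    Tendsto a atTop (𝓝 0) := by
  have tendsto_iInf : Tendsto a atTop (𝓝 (⨅ t, a t)) :=
    tendsto_atTop_ciInf hanti ⟨0, Set.forall_mem_range.mpr hnonneg⟩
  have iInf_nonneg : 0 ≤ ⨅ t, a t := le_ciInf hnonneg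
  have iInf_le : ⨅ t, a t ≤ r * ⨅ t, a t :=
    le_of_tendsto_of_tendsto' (tendsto_iInf.comp (tendsto_add_atTop_nat N))
      (tendsto_iInf.const_mul r) h
  have iInf_eq : ⨅ t, a t = 0 := by nlinarith
  rwa [iInf_eq] at tendsto_iInf

theorem tendsto_tvDist_chainLaw {K : α → PMF α} {π : PMF α} (hπ : π.bind K = π) {x₀ : α}
    (hx₀ : x₀ ∈ (K x₀).support)
    (hacc : ∀ x, Relation.ReflTransGen (fun x y => y ∈ (K x).support) x x₀) (μ : PMF α) :
    Tendsto (fun t => tvDist (chainLaw K μ t) π) atTop (𝓝 0) := by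
  obtain ⟨N, hN⟩ :=
    (eventually_all.mpr fun x => eventually_mem_support_chainLaw hx₀ (hacc x)).exists
  obtain ⟨r, hr, contract⟩ := exists_lt_one_tvDist_bind_le (fun x => chainLaw K (PMF.pure x) N) hN
  refine tendsto_zero_of_antitone_of_add_le_mul (antitone_nat_of_succ_le fun t => ?_)
    (fun t => tvDist_nonneg _ _) hr (N := N) fun t => ?_
  · simpa only [chainLaw_succ, hπ] using tvDist_bind_le_tvDist K (chainLaw K μ t) π
  · have := contract (chainLaw K μ t) (chainLaw K π 0)
    rw [← chainLaw_add, ← chainLaw_add] at this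
    simpa only [chainLaw_of_bind_eq hπ] using this

end FiniteChain

section DrawAndAccept

variable {α ι κ : Type*}

theorem drawOr_eq_bind {s : Finset ι} (hs : s.Nonempty) (y : α) (f : ι → PMF α) :
    drawOr s y f = (PMF.uniformOfFinset s hs).bind f :=
  dif_pos hs

theorem drawOr_empty (y : α) (f : ι → PMF α) : drawOr ∅ y f = PMF.pure y :=
  dif_neg Finset.not_nonempty_empty

theorem drawOr_pure_self (s : Finset ι) (y : α) :
    (drawOr s y fun _ => PMF.pure y) = PMF.pure y := by
  rcases s.eq_empty_or_nonempty with rfl | hs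
  · exact drawOr_empty _ _
  · rw [drawOr_eq_bind hs, PMF.bind_const]

theorem drawOr_apply {s : Finset ι} (hs : s.Nonempty) (y : α) (f : ι → PMF α) (z : α) :
    drawOr s y f z = (s.card : ENNReal)⁻¹ * ∑ i ∈ s, f i z := by
  rw [drawOr_eq_bind hs, PMF.bind_apply, tsum_eq_sum (s := s), Finset.mul_sum]
  · exact Finset.sum_congr rfl fun i hi => by rw [PMF.uniformOfFinset_apply_of_mem hs hi]
  · intro i hi
    rw [PMF.uniformOfFinset_apply_of_notMem hs hi, zero_mul]

theorem drawOr_congr {s : Finset ι} {y : α} {f g : ι → PMF α} (h : ∀ i ∈ s, f i = g i) :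
    drawOr s y f = drawOr s y g := by
  rcases s.eq_empty_or_nonempty with rfl | hs
  · rw [drawOr_empty, drawOr_empty]
  ext z
  rw [drawOr_apply hs, drawOr_apply hs, Finset.sum_congr rfl fun i hi => by rw [h i hi]]

theorem drawOr_comm (s : Finset ι) (t : Finset κ) (y : α) (f : ι → κ → PMF α) :
    (drawOr s y fun i => drawOr t y fun j => f i j) =
      drawOr t y fun j => drawOr s y fun i => f i j := by
  rcases s.eq_empty_or_nonempty with rfl | hs
  · simp only [drawOr_empty, drawOr_pure_self]
  rcases t.eq_empty_or_nonempty with rfl | ht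
  · simp only [drawOr_empty, drawOr_pure_self]
  simp only [drawOr_eq_bind hs, drawOr_eq_bind ht]
  exact PMF.bind_comm _ _ _

theorem drawOr_sigma {s : Finset ι} {t : ι → Finset κ} {n : ℕ} (ht : ∀ i ∈ s, (t i).card = n)
    (y : α) (f : ι → κ → PMF α) :
    (drawOr s y fun i => drawOr (t i) y fun j => f i j) =
      drawOr (s.sigma t) y fun p => f p.1 p.2 := by
  rcases (s.sigma t).eq_empty_or_nonempty with hst | hst
  · have t_empty : ∀ i ∈ s, t i = ∅ := Finset.sigma_eq_empty.mp hst
    rw [hst, drawOr_empty, drawOr_congr fun i hi => by rw [t_empty i hi, drawOr_empty],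
      drawOr_pure_self]
  obtain ⟨⟨i₀, j₀⟩, h₀⟩ := hst
  obtain ⟨hi₀, hj₀⟩ := Finset.mem_sigma.mp h₀
  have hn : n ≠ 0 := ht i₀ hi₀ ▸ Finset.card_ne_zero_of_mem hj₀
  have t_nonempty : ∀ i ∈ s, (t i).Nonempty := fun i hi =>
    Finset.card_ne_zero.mp (ht i hi ▸ hn)
  ext z
  calc drawOr s y (fun i => drawOr (t i) y fun j => f i j) z
      = (s.card : ENNReal)⁻¹ * ∑ i ∈ s, (n : ENNReal)⁻¹ * ∑ j ∈ t i, f i j z := by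
        rw [drawOr_apply ⟨i₀, hi₀⟩]
        congr 1
        exact Finset.sum_congr rfl fun i hi => by rw [drawOr_apply (t_nonempty i hi), ht i hi]
    _ = ((s.sigma t).card : ENNReal)⁻¹ * ∑ p ∈ s.sigma t, f p.1 p.2 z := by
        rw [← Finset.mul_sum, ← mul_assoc, Finset.sum_sigma, Finset.card_sigma,
          Finset.sum_const_nat ht, Nat.cast_mul, ENNReal.mul_inv (.inr (ENNReal.natCast_ne_top n))
            (.inl (ENNReal.natCast_ne_top _))]
    _ = drawOr (s.sigma t) y (fun p => f p.1 p.2) z := (drawOr_apply ⟨_, h₀⟩ _ _ _).symm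

theorem mem_support_drawOr {s : Finset ι} {i : ι} (hi : i ∈ s) {x y : α} {f : ι → PMF α}
    (hy : y ∈ (f i).support) : y ∈ (drawOr s x f).support := by
  rw [drawOr_eq_bind ⟨i, hi⟩, PMF.mem_support_bind_iff]
  exact ⟨i, (PMF.mem_support_uniformOfFinset_iff _ _).mpr hi, hy⟩

theorem acceptProb_eq (r : ℝ) : acceptProb r = ENNReal.ofReal (min 1 r) := by
  have Iic_inter_Icc : Set.Iic r ∩ Set.Icc 0 1 = Set.Icc 0 (min 1 r) := by
    rw [Set.inter_comm, ← Set.Ici_inter_Iic, Set.inter_assoc, Set.Iic_inter_Iic,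
      Set.Ici_inter_Iic]
  rw [acceptProb, uniformUnitInterval, Measure.restrict_apply measurableSet_Iic, Iic_inter_Icc,
    Real.volume_Icc, sub_zero]

theorem acceptOr_self (r : ℝ) (x : α) : acceptOr r x x = PMF.pure x := by
  simp only [acceptOr, ite_self]
  exact PMF.map_const _ _

theorem mem_support_acceptOr {r : ℝ} (hr : 0 < r) (x y : α) : x ∈ (acceptOr r x y).support := by
  rw [acceptOr, PMF.mem_support_map_iff]
  refine ⟨true, ?_, rfl⟩
  simpa [acceptProb_eq] using hr

theorem acceptOr_apply_of_ne (r : ℝ) {x y z : α} (hz : z ≠ y) :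
    acceptOr r x y z = acceptProb r * PMF.pure x z := by
  classical
  rw [acceptOr, PMF.map_apply, tsum_fintype, Fintype.sum_bool]
  simp [hz, PMF.pure_apply]

theorem bind_acceptOr_apply_of_ne (q : PMF α) (r : α → ℝ) {x y : α} (hxy : y ≠ x) :
    (q.bind fun z => acceptOr (r z) z x) y = q y * acceptProb (r y) := by
  rw [PMF.bind_apply, tsum_eq_single y]
  · rw [acceptOr_apply_of_ne _ hxy, PMF.pure_apply_self, mul_one]
  · intro z hz
    rw [acceptOr_apply_of_ne _ hxy, PMF.pure_apply_of_ne _ _ hz.symm, mul_zero, mul_zero]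

end DrawAndAccept

section DetailedBalance

variable {α ι : Type*}

/-- Detailed balance of the transition kernel `K` with respect to the weights `w`. A symmetric
kernel is one in detailed balance with respect to the constant weight `1`. -/
def DetailedBalance (K : α → PMF α) (w : α → ENNReal) : Prop :=
  ∀ x y, w x * K x y = w y * K y x

theorem detailedBalance_of_ne {K : α → PMF α} {w : α → ENNReal}
    (h : ∀ x y, y ≠ x → w x * K x y = w y * K y x) : DetailedBalance K w := by
  intro x y
  rcases eq_or_ne y x with rfl | hxy
  · rfl
  · exact h x y hxy

theorem DetailedBalance.bind_eq {K : α → PMF α} {π : PMF α} (h : DetailedBalance K π) :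
    π.bind K = π := by
  ext y
  simp only [PMF.bind_apply, h _ y, ENNReal.tsum_mul_left, PMF.tsum_coe, mul_one]

theorem detailedBalance_pure (w : α → ENNReal) : DetailedBalance PMF.pure w :=
  detailedBalance_of_ne fun x y hxy => by
    rw [PMF.pure_apply_of_ne _ _ hxy, PMF.pure_apply_of_ne _ _ hxy.symm, mul_zero, mul_zero]

theorem detailedBalance_bind (p : PMF ι) {K : ι → α → PMF α} {w : α → ENNReal}
    (h : ∀ i, DetailedBalance (K i) w) : DetailedBalance (fun x => p.bind fun i => K i x) w := by
  intro x y
  simp only [PMF.bind_apply, ← ENNReal.tsum_mul_left, mul_left_comm (w _), h _ x y]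

theorem detailedBalance_drawOr (s : Finset ι) {K : ι → α → PMF α} {w : α → ENNReal}
    (h : ∀ i, DetailedBalance (K i) w) :
    DetailedBalance (fun x => drawOr s x fun i => K i x) w := by
  rcases s.eq_empty_or_nonempty with rfl | hs
  · simpa only [drawOr_empty] using detailedBalance_pure w
  · simpa only [drawOr_eq_bind hs] using detailedBalance_bind _ h

theorem detailedBalance_pure_of_involutive {f : α → α} (hf : Function.Involutive f) :
    DetailedBalance (fun x => PMF.pure (f x)) 1 := by
  classical
  intro x y
  have eq_iff : y = f x ↔ x = f y := eq_comm.trans hf.eq_iff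
  simp only [PMF.pure_apply, eq_iff, Pi.one_apply]

/- The reverse of the move `i` is the move `σ i`. -/
theorem detailedBalance_drawOr_pure {s : α → Finset ι} {f : α → ι → α} {σ : ι → ι}
    (hσ : Function.Injective σ) (hcard : ∀ x, ∀ i ∈ s x, f x i ≠ x → (s (f x i)).card = (s x).card)
    (hmem : ∀ x, ∀ i ∈ s x, f x i ≠ x → σ i ∈ s (f x i))
    (hrev : ∀ x, ∀ i ∈ s x, f x i ≠ x → f (f x i) (σ i) = x) :
    DetailedBalance (fun x => drawOr (s x) x fun i => PMF.pure (f x i)) 1 := by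
  classical
  suffices drawOr_le : ∀ x y, y ≠ x → drawOr (s x) x (fun i => PMF.pure (f x i)) y ≤
      drawOr (s y) y (fun i => PMF.pure (f y i)) x by
    refine detailedBalance_of_ne fun x y hxy => ?_
    simpa only [Pi.one_apply, one_mul] using (drawOr_le x y hxy).antisymm (drawOr_le y x hxy.symm)
  intro x y hxy
  by_cases hmove : ∃ i ∈ s x, f x i = y
  · obtain ⟨i, hi, rfl⟩ := hmove
    rw [drawOr_apply ⟨i, hi⟩, drawOr_apply ⟨σ i, hmem x i hi hxy⟩, hcard x i hi hxy]
    simp only [PMF.pure_apply, Finset.sum_boole]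
    refine mul_le_mul' le_rfl
      (Nat.cast_le.mpr (Finset.card_le_card_of_injOn σ (fun j hj => ?_) hσ.injOn))
    obtain ⟨hj, hji⟩ := Finset.mem_filter.mp hj
    rw [hji] at hxy ⊢
    exact Finset.mem_filter.mpr ⟨hmem x j hj hxy, (hrev x j hj hxy).symm⟩
  · suffices drawOr (s x) x (fun i => PMF.pure (f x i)) y = 0 from this.trans_le zero_le
    rcases (s x).eq_empty_or_nonempty with hs | hs
    · rw [hs, drawOr_empty, PMF.pure_apply_of_ne _ _ hxy]
    · rw [drawOr_apply hs, Finset.sum_eq_zero fun i hi => PMF.pure_apply_of_ne _ _ fun h =>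
        hmove ⟨i, hi, h.symm⟩, mul_zero]

theorem detailedBalance_metropolis {q : α → PMF α} (hq : DetailedBalance q 1) {W : α → ℝ}
    (hW : ∀ x, 0 < W x) :
    DetailedBalance (fun x => (q x).bind fun y => acceptOr (W y / W x) y x)
      fun x => ENNReal.ofReal (W x) := by
  have mul_acceptProb : ∀ x y, ENNReal.ofReal (W x) * acceptProb (W y / W x) =
      ENNReal.ofReal (min (W x) (W y)) := fun x y => by
    rw [acceptProb_eq, ← ENNReal.ofReal_mul (hW x).le,
      mul_min_of_nonneg _ _ (hW x).le, mul_one, mul_div_cancel₀ _ (hW x).ne']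
  have symm : ∀ x y, q x y = q y x := by simpa [DetailedBalance] using hq
  refine detailedBalance_of_ne fun x y hxy => ?_
  rw [bind_acceptOr_apply_of_ne _ _ hxy, bind_acceptOr_apply_of_ne _ _ hxy.symm,
    mul_left_comm, mul_acceptProb, mul_left_comm, mul_acceptProb, symm x y, min_comm]

end DetailedBalance

section Product

variable {ι : Type*} [DecidableEq ι]

theorem map_update_apply {α : ι → Type*} (i : ι) (p : PMF (α i)) (s s' : ∀ j, α j)
    [Decidable (∀ j ≠ i, s' j = s j)] :
    (p.map fun b => Function.update s i b) s' = if ∀ j ≠ i, s' j = s j then p (s' i) else 0 := by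
  classical
  simp only [PMF.map_apply, Function.eq_update_iff]
  split_ifs with h
  · simp only [and_iff_left h]
    rw [tsum_eq_single (s' i) fun b hb => if_neg hb.symm, if_pos rfl]
  · simp only [h, and_false, if_false, tsum_zero]

theorem reflTransGen_of_reflTransGen_update [Finite ι] {α : ι → Type*}
    {r : (∀ i, α i) → (∀ i, α i) → Prop} {s' : ∀ i, α i}
    (h : ∀ s i, Relation.ReflTransGen r s (Function.update s i (s' i))) (s : ∀ i, α i) :
    Relation.ReflTransGen r s s' := by
  cases nonempty_fintype ι
  have reach_piecewise : ∀ S : Finset ι, Relation.ReflTransGen r s (S.piecewise s' s) := by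
    intro S
    induction S using Finset.induction_on with
    | empty => rw [Finset.piecewise_empty]
    | insert i S _ ih =>
      rw [Finset.piecewise_insert]
      exact ih.trans (h _ i)
  simpa only [Finset.piecewise_univ] using reach_piecewise Finset.univ

variable [Fintype ι]

theorem detailedBalance_update {α : ι → Type*} (i : ι) {K : α i → PMF (α i)}
    {w : ∀ j, α j → ENNReal} (h : DetailedBalance K (w i)) :
    DetailedBalance (fun s : ∀ j, α j => (K (s i)).map fun b => Function.update s i b)
      fun s => ∏ j, w j (s j) := by
  classical
  intro s s'
  simp only [map_update_apply, eq_comm (a := s _)]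
  split_ifs with hoff
  · have prod_erase : ∏ j ∈ Finset.univ.erase i, w j (s' j) =
        ∏ j ∈ Finset.univ.erase i, w j (s j) :=
      Finset.prod_congr rfl fun j hj => by rw [hoff j (Finset.ne_of_mem_erase hj)]
    rw [← Finset.mul_prod_erase _ _ (Finset.mem_univ i),
      ← Finset.mul_prod_erase _ (fun j => w j (s' j)) (Finset.mem_univ i), prod_erase,
      mul_right_comm, h, mul_right_comm]
  · rw [mul_zero, mul_zero]

theorem prod_comp_swap_div_prod {α : Type*} {W : ι → α → ℝ} (hW : ∀ i x, W i x ≠ 0) {i j : ι}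
    (hij : i ≠ j) (s : ι → α) :
    (∏ k, W k ((s ∘ Equiv.swap i j) k)) / ∏ k, W k (s k) =
      (W j (s i) * W i (s j)) / (W i (s i) * W j (s j)) := by
  have eq_one : ∀ k, k ≠ i ∧ k ≠ j → W k ((s ∘ Equiv.swap i j) k) / W k (s k) = 1 := by
    rintro k ⟨hki, hkj⟩
    rw [Function.comp_apply, Equiv.swap_apply_of_ne_of_ne hki hkj, div_self (hW k _)]
  rw [← Finset.prod_div_distrib, Fintype.prod_eq_mul i j hij eq_one, div_mul_div_comm]
  simp only [Function.comp_apply, Equiv.swap_apply_left, Equiv.swap_apply_right, mul_comm]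

theorem detailedBalance_swap {α : Type*} {W : ι → α → ℝ} (hW : ∀ i x, 0 < W i x) {i j : ι}
    (hij : i ≠ j) :
    DetailedBalance
      (fun s : ι → α => acceptOr ((W j (s i) * W i (s j)) / (W i (s i) * W j (s j)))
        (s ∘ Equiv.swap i j) s)
      fun s => ∏ k, ENNReal.ofReal (W k (s k)) := by
  have swap_involutive : Function.Involutive fun s : ι → α => s ∘ Equiv.swap i j := fun s => by
    ext k
    simp only [Function.comp_apply, Equiv.swap_apply_self]
  have := detailedBalance_metropolis (detailedBalance_pure_of_involutive swap_involutive)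
    (W := fun s => ∏ k, W k (s k)) fun s => Finset.prod_pos fun k _ => hW k (s k)
  simpa only [PMF.pure_bind, prod_comp_swap_div_prod (fun k x => (hW k x).ne') hij,
    ENNReal.ofReal_prod_of_nonneg fun k _ => (hW k _).le] using this

end Product

section ProductMeasure

variable {ι : Type*} [Fintype ι] {α : ι → Type*} [∀ i, Countable (α i)]
  [∀ i, MeasurableSpace (α i)] [∀ i, MeasurableSingletonClass (α i)]
  {π : PMF (∀ i, α i)} {p : ∀ i, PMF (α i)}

theorem toMeasure_eq_pi (h : ∀ s, π s = ∏ i, p i (s i)) :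
    π.toMeasure = Measure.pi fun i => (p i).toMeasure := by
  refine Measure.ext_of_singleton fun s => ?_
  rw [PMF.toMeasure_apply_singleton _ _ (measurableSet_singleton s), Measure.pi_singleton, h]
  exact Finset.prod_congr rfl fun i _ =>
    (PMF.toMeasure_apply_singleton _ _ (measurableSet_singleton _)).symm

theorem iIndepFun_eval_of_apply_eq_prod (h : ∀ s, π s = ∏ i, p i (s i)) :
    iIndepFun (fun (i : ι) (s : ∀ i, α i) => s i) π.toMeasure := by
  rw [toMeasure_eq_pi h]
  exact iIndepFun_pi (X := fun _ x => x) fun _ => aemeasurable_id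

theorem map_eval_of_apply_eq_prod (h : ∀ s, π s = ∏ i, p i (s i)) (i : ι) :
    π.map (fun s => s i) = p i := by
  apply PMF.toMeasure_injective
  rw [← PMF.toMeasure_map _ _ (measurable_pi_apply i), toMeasure_eq_pi h]
  exact (measurePreserving_eval (fun i => (p i).toMeasure) i).map_eq

end ProductMeasure

section Exchange

variable {E : Type*} [DecidableEq E] {H F G : Finset E}

theorem subset_union_sdiff_of_disjoint (hG : G ⊆ H) (hF : Disjoint F H) : F ⊆ (H ∪ F) \ G :=
  Finset.subset_sdiff.mpr ⟨Finset.subset_union_right, hF.mono_right hG⟩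

theorem union_sdiff_union_sdiff_of_disjoint (hG : G ⊆ H) (hF : Disjoint F H) :
    ((H ∪ F) \ G ∪ G) \ F = H := by
  rw [Finset.sdiff_union_of_subset (hG.trans Finset.subset_union_left),
    Finset.union_sdiff_cancel_right hF.symm]

theorem card_union_sdiff_of_disjoint (hG : G ⊆ H) (hF : Disjoint F H) (h : F.card = G.card) :
    ((H ∪ F) \ G).card = H.card := by
  rw [Finset.card_sdiff_of_subset (hG.trans Finset.subset_union_left),
    Finset.card_union_of_disjoint hF.symm, h, Nat.add_sub_cancel]

end Exchange

section Proposal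

variable {A B C : Type*}

theorem replaceVertex_self (X : VertexClass) (e : Hyperedge A B C) : replaceVertex X e e = e := by
  cases X <;> rfl

theorem replaceVertex_replaceVertex (X : VertexClass) (e₁ e₂ : Hyperedge A B C) :
    replaceVertex X (replaceVertex X e₁ e₂) (replaceVertex X e₂ e₁) = e₁ := by
  cases X <;> rfl

variable [DecidableEq A] [DecidableEq B] [DecidableEq C]

theorem toggleAt_involutive (e : Hyperedge A B C) :
    Function.Involutive fun H : PartiteHypergraph A B C => toggleAt H e := by
  intro H
  by_cases he : e ∈ H
  · simp [toggleAt, he]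
  · simp [toggleAt, he, Finset.sdiff_singleton_eq_erase]

theorem hingeFlipAt_reverse {H : PartiteHypergraph A B C} {e e' : Hyperedge A B C} (he : e ∈ H)
    (hne : hingeFlipAt H e e' ≠ H) :
    (hingeFlipAt H e e').card = H.card ∧ e' ∈ hingeFlipAt H e e' ∧
      hingeFlipAt (hingeFlipAt H e e') e' e = H := by
  have he' : e' ∉ H := fun he' => hne (if_neg (not_not.mpr he'))
  have old_subset : {e} ⊆ H := Finset.singleton_subset_iff.mpr he
  have new_disjoint : Disjoint {e'} H := Finset.disjoint_singleton_left.mpr he'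
  have flip_eq : hingeFlipAt H e e' = (H ∪ {e'}) \ {e} := if_pos he'
  have e_notMem : e ∉ (H ∪ {e'}) \ {e} := by simp
  rw [flip_eq, hingeFlipAt, if_pos e_notMem]
  exact ⟨card_union_sdiff_of_disjoint old_subset new_disjoint rfl,
    Finset.singleton_subset_iff.mp (subset_union_sdiff_of_disjoint old_subset new_disjoint),
    union_sdiff_union_sdiff_of_disjoint old_subset new_disjoint⟩

theorem switchAt_reverse {H : PartiteHypergraph A B C} {e₁ e₂ : Hyperedge A B C} {X : VertexClass}
    (h₁ : e₁ ∈ H) (h₂ : e₂ ∈ H) (hne : switchAt H e₁ e₂ X ≠ H) :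
    (switchAt H e₁ e₂ X).card = H.card ∧
      (replaceVertex X e₁ e₂ ∈ switchAt H e₁ e₂ X ∧ replaceVertex X e₂ e₁ ∈ switchAt H e₁ e₂ X) ∧
      switchAt (switchAt H e₁ e₂ X) (replaceVertex X e₁ e₂) (replaceVertex X e₂ e₁) X = H := by
  have hnew : replaceVertex X e₁ e₂ ∉ H ∧ replaceVertex X e₂ e₁ ∉ H := by
    by_contra hold
    exact hne (if_neg hold)
  have switch_eq : switchAt H e₁ e₂ X =
      (H ∪ {replaceVertex X e₁ e₂, replaceVertex X e₂ e₁}) \ {e₁, e₂} := if_pos hnew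
  have old_subset : {e₁, e₂} ⊆ H :=
    Finset.insert_subset h₁ (Finset.singleton_subset_iff.mpr h₂)
  have new_disjoint : Disjoint {replaceVertex X e₁ e₂, replaceVertex X e₂ e₁} H := by
    simpa using hnew
  have old_ne : e₁ ≠ e₂ := by
    rintro rfl
    exact hnew.1 (by rwa [replaceVertex_self])
  have new_ne : replaceVertex X e₁ e₂ ≠ replaceVertex X e₂ e₁ := fun h => old_ne <| by
    calc e₁ = replaceVertex X (replaceVertex X e₁ e₂) (replaceVertex X e₂ e₁) :=
          (replaceVertex_replaceVertex X e₁ e₂).symm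
      _ = replaceVertex X (replaceVertex X e₂ e₁) (replaceVertex X e₁ e₂) := by rw [h]
      _ = e₂ := replaceVertex_replaceVertex X e₂ e₁
  have old_notMem : e₁ ∉ (H ∪ {replaceVertex X e₁ e₂, replaceVertex X e₂ e₁}) \ {e₁, e₂} ∧
      e₂ ∉ (H ∪ {replaceVertex X e₁ e₂, replaceVertex X e₂ e₁}) \ {e₁, e₂} := by simp
  rw [switch_eq, switchAt, replaceVertex_replaceVertex, replaceVertex_replaceVertex,
    if_pos old_notMem]
  exact ⟨card_union_sdiff_of_disjoint old_subset new_disjoint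
      (by rw [Finset.card_pair old_ne, Finset.card_pair new_ne]),
    by simpa only [Finset.insert_subset_iff, Finset.singleton_subset_iff] using
      subset_union_sdiff_of_disjoint old_subset new_disjoint,
    union_sdiff_union_sdiff_of_disjoint old_subset new_disjoint⟩

theorem detailedBalance_switchProposal :
    DetailedBalance (switchProposal (A := A) (B := B) (C := C)) 1 := by
  have eq_drawOr_sigma : switchProposal (A := A) (B := B) (C := C) = fun H =>
      drawOr (H.sigma fun _ => H.sigma fun _ => (Finset.univ : Finset VertexClass)) H fun p =>
        PMF.pure (switchAt H p.1 p.2.1 p.2.2) := by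
    funext H
    simp only [switchProposal, drawOr_sigma fun _ _ => rfl]
  have reverse_involutive : Function.Involutive
      fun p : (_ : Hyperedge A B C) × (_ : Hyperedge A B C) × VertexClass =>
        (⟨replaceVertex p.2.2 p.1 p.2.1, replaceVertex p.2.2 p.2.1 p.1, p.2.2⟩ :
          (_ : Hyperedge A B C) × (_ : Hyperedge A B C) × VertexClass) := by
    rintro ⟨e₁, e₂, X⟩
    simp only [replaceVertex_replaceVertex]
  rw [eq_drawOr_sigma]
  refine detailedBalance_drawOr_pure reverse_involutive.injective ?_ ?_ ?_
  all_goals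
    rintro H ⟨e₁, e₂, X⟩ hp hne
    simp only [Finset.mem_sigma, Finset.mem_univ, and_true] at hp ⊢
    obtain ⟨card_eq, mem, reverse⟩ := switchAt_reverse hp.1 hp.2 hne
  · simp only [Finset.card_sigma, Finset.sum_const, card_eq]
  · exact mem
  · exact reverse

/- `φ` splits a hyperedge into its vertex in one class and its other two vertices. -/
theorem detailedBalance_drawOr_hingeFlipAt {V W : Type*} [Fintype V] [DecidableEq V]
    (φ : Hyperedge A B C ≃ V × W) :
    DetailedBalance (fun H : PartiteHypergraph A B C =>
      drawOr H H fun e => drawOr (Finset.univ.filter fun x => x ≠ (φ e).1) H fun x =>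
        PMF.pure (hingeFlipAt H e (φ.symm (x, (φ e).2)))) 1 := by
  have card_ne : ∀ H : PartiteHypergraph A B C, ∀ e ∈ H,
      (Finset.univ.filter fun x => x ≠ (φ e).1).card = Fintype.card V - 1 := fun H e _ => by
    rw [Finset.filter_ne', Finset.card_erase_of_mem (Finset.mem_univ _), Finset.card_univ]
  have eq_drawOr_sigma : (fun H : PartiteHypergraph A B C =>
      drawOr H H fun e => drawOr (Finset.univ.filter fun x => x ≠ (φ e).1) H fun x =>
        PMF.pure (hingeFlipAt H e (φ.symm (x, (φ e).2)))) = fun H =>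
      drawOr (H.sigma fun e => Finset.univ.filter fun x => x ≠ (φ e).1) H fun p =>
        PMF.pure (hingeFlipAt H p.1 (φ.symm (p.2, (φ p.1).2))) := by
    funext H
    exact drawOr_sigma (card_ne H) _ _
  have reverse_involutive : Function.Involutive fun p : (_ : Hyperedge A B C) × V =>
      (⟨φ.symm (p.2, (φ p.1).2), (φ p.1).1⟩ : (_ : Hyperedge A B C) × V) := by
    rintro ⟨e, x⟩
    simp
  rw [eq_drawOr_sigma]
  refine detailedBalance_drawOr_pure reverse_involutive.injective ?_ ?_ ?_
  all_goals
    rintro H ⟨e, x⟩ hp hne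
    obtain ⟨he, hx⟩ := Finset.mem_sigma.mp hp
    obtain ⟨card_eq, mem, reverse⟩ := hingeFlipAt_reverse he hne
  · simp only [Finset.card_sigma, Finset.sum_const_nat (card_ne _), card_eq]
  · simpa [mem, eq_comm] using hx
  · simpa using reverse

variable [Fintype A] [Fintype B] [Fintype C]

theorem detailedBalance_hingeFlipProposal :
    DetailedBalance (hingeFlipProposal (A := A) (B := B) (C := C)) 1 := by
  unfold hingeFlipProposal
  simp only [drawOr_comm _ (Finset.univ : Finset VertexClass)]
  refine detailedBalance_drawOr _ fun X => ?_
  cases X with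
  | A => exact detailedBalance_drawOr_hingeFlipAt (Equiv.refl (A × B × C))
  | B =>
    exact detailedBalance_drawOr_hingeFlipAt <|
      (Equiv.prodAssoc A B C).symm.trans <|
        ((Equiv.prodComm A B).prodCongr (Equiv.refl C)).trans (Equiv.prodAssoc B A C)
  | C =>
    exact detailedBalance_drawOr_hingeFlipAt <|
      (Equiv.prodAssoc A B C).symm.trans (Equiv.prodComm (A × B) C)

theorem detailedBalance_toggleProposal :
    DetailedBalance (toggleProposal (A := A) (B := B) (C := C)) 1 :=
  detailedBalance_drawOr _ fun e => detailedBalance_pure_of_involutive (toggleAt_involutive e)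

theorem detailedBalance_proposal : DetailedBalance (proposal (A := A) (B := B) (C := C)) 1 := by
  refine detailedBalance_bind _ fun j => ?_
  fin_cases j
  · exact detailedBalance_switchProposal
  · exact detailedBalance_hingeFlipProposal
  · exact detailedBalance_toggleProposal

theorem toggleAt_mem_support_proposal (H : PartiteHypergraph A B C) (e : Hyperedge A B C) :
    toggleAt H e ∈ (proposal H).support := by
  rw [proposal, PMF.mem_support_bind_iff]
  exact ⟨2, PMF.mem_support_uniformOfFintype _,
    mem_support_drawOr (Finset.mem_univ e) ((PMF.mem_support_pure_iff _ _).mpr rfl)⟩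

end Proposal

section ParallelTempering

variable {A B C : Type*} [Fintype A] [Fintype B] [Fintype C]
  [DecidableEq A] [DecidableEq B] [DecidableEq C] (D : DegreeSequence A B C)

theorem boltzmannDensity_pos (T : ℝ) (H : PartiteHypergraph A B C) :
    0 < boltzmannWeight D T H / partitionFunction D T :=
  div_pos (boltzmannWeight_pos D T H) (partitionFunction_pos D T)

theorem detailedBalance_metropolisStep (T : ℝ) :
    DetailedBalance (metropolisStep D T) (boltzmann D T) := by
  have := detailedBalance_metropolis detailedBalance_proposal (boltzmannDensity_pos D T)
  simp only [div_div_div_cancel_right₀ (partitionFunction_pos D T).ne'] at this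
  exact this

theorem toggleAt_mem_support_metropolisStep (T : ℝ) (H : PartiteHypergraph A B C)
    (e : Hyperedge A B C) : toggleAt H e ∈ (metropolisStep D T H).support := by
  rw [metropolisStep, PMF.mem_support_bind_iff]
  exact ⟨toggleAt H e, toggleAt_mem_support_proposal H e,
    mem_support_acceptOr (div_pos (boltzmannWeight_pos D T _) (boltzmannWeight_pos D T _)) _ _⟩

theorem reflTransGen_metropolisStep_empty (T : ℝ) (H : PartiteHypergraph A B C) :
    Relation.ReflTransGen (fun H H' => H' ∈ (metropolisStep D T H).support) H ∅ := by
  induction H using Finset.induction_on with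
  | empty => exact .refl
  | insert e H he ih =>
    have toggle_insert : toggleAt (insert e H) e = H := by
      simp [toggleAt, he, Finset.sdiff_singleton_eq_erase]
    refine .head ?_ ih
    simpa only [toggle_insert] using toggleAt_mem_support_metropolisStep D T (insert e H) e

theorem swapRatio_eq_density (T T' : ℝ) (H H' : PartiteHypergraph A B C) :
    swapRatio D T T' H H' =
      ((boltzmannWeight D T' H / partitionFunction D T') *
        (boltzmannWeight D T H' / partitionFunction D T)) /
      ((boltzmannWeight D T H / partitionFunction D T) *
        (boltzmannWeight D T' H' / partitionFunction D T')) := by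
  have hZ := (partitionFunction_pos D T).ne'
  have hZ' := (partitionFunction_pos D T').ne'
  rw [swapRatio]
  field_simp

variable {n : ℕ} (T : Fin (n + 1) → ℝ)

theorem detailedBalance_parallelTemperingStep :
    DetailedBalance (parallelTemperingStep D T) (boltzmannProduct D T) := by
  refine detailedBalance_bind _ fun b => ?_
  cases b with
  | true =>
    exact detailedBalance_drawOr _ fun i =>
      detailedBalance_update i (detailedBalance_metropolisStep D (T i))
  | false =>
    refine detailedBalance_drawOr _ fun i => ?_
    simp only [swapRatio_eq_density]
    exact detailedBalance_swap (fun i H => boltzmannDensity_pos D (T i) H) i.castSucc_lt_succ.ne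

theorem update_mem_support_parallelTemperingStep {s : Fin (n + 1) → PartiteHypergraph A B C}
    {i : Fin (n + 1)} {H : PartiteHypergraph A B C}
    (hH : H ∈ (metropolisStep D (T i) (s i)).support) :
    Function.update s i H ∈ (parallelTemperingStep D T s).support := by
  rw [parallelTemperingStep, PMF.mem_support_bind_iff]
  exact ⟨true, PMF.mem_support_uniformOfFintype _,
    mem_support_drawOr (Finset.mem_univ i) ((PMF.mem_support_map_iff _ _ _).mpr ⟨H, hH, rfl⟩)⟩

theorem reflTransGen_parallelTemperingStep_empty (s : Fin (n + 1) → PartiteHypergraph A B C) :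
    Relation.ReflTransGen (fun s s' => s' ∈ (parallelTemperingStep D T s).support) s
      fun _ => ∅ := by
  refine reflTransGen_of_reflTransGen_update (fun s i => ?_) s
  have step_update : ∀ H H', H' ∈ (metropolisStep D (T i) H).support →
      Function.update s i H' ∈ (parallelTemperingStep D T (Function.update s i H)).support :=
    fun H H' hH' => by
      simpa only [Function.update_idem] using update_mem_support_parallelTemperingStep D T
        (s := Function.update s i H) (i := i) (by rwa [Function.update_self])
  have lift_update : Relation.ReflTransGen
      (fun s s' => s' ∈ (parallelTemperingStep D T s).support)
      (Function.update s i (s i)) (Function.update s i ∅) :=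
    (reflTransGen_metropolisStep_empty D (T i) (s i)).lift (Function.update s i) step_update
  rwa [Function.update_eq_self] at lift_update

theorem const_mem_support_parallelTemperingStep (H : PartiteHypergraph A B C) :
    (fun _ => H) ∈ (parallelTemperingStep D T fun _ => H).support := by
  rw [parallelTemperingStep, PMF.mem_support_bind_iff]
  refine ⟨false, PMF.mem_support_uniformOfFintype _, ?_⟩
  have comp_swap : ∀ i j : Fin (n + 1), (fun _ => H) ∘ Equiv.swap i j = fun _ => H :=
    fun _ _ => rfl
  simp only [Bool.false_eq_true, if_false, comp_swap, acceptOr_self, drawOr_pure_self,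
    PMF.mem_support_pure_iff]

theorem tendsto_tvDist_parallelTemperingLaw
    (μ : PMF (Fin (n + 1) → PartiteHypergraph A B C)) :
    Tendsto (fun t => tvDist (parallelTemperingLaw D T μ t) (boltzmannProduct D T))
      atTop (𝓝 0) :=
  tendsto_tvDist_chainLaw (detailedBalance_parallelTemperingStep D T).bind_eq
    (const_mem_support_parallelTemperingStep D T ∅)
    (reflTransGen_parallelTemperingStep_empty D T) μ

theorem boltzmannProduct_apply {k : ℕ} (T : Fin k → ℝ) (s : Fin k → PartiteHypergraph A B C) :
    boltzmannProduct D T s = ∏ i, boltzmann D (T i) (s i) :=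
  rfl

end ParallelTempering

theorem mainTheorem5_general {A B C : Type*} [Fintype A] [Fintype B] [Fintype C]
    [DecidableEq A] [DecidableEq B] [DecidableEq C] (D : DegreeSequence A B C)
    (n : ℕ) (T : Fin (n + 1) → ℝ) (_hT : ∀ i, T i ≠ 0) :
    (∀ μ : PMF (Fin (n + 1) → PartiteHypergraph A B C),
      Tendsto (fun t => tvDist (parallelTemperingLaw D T μ t) (boltzmannProduct D T))
        atTop (𝓝 0)) ∧
    iIndepFun (fun (i : Fin (n + 1)) (s : Fin (n + 1) → PartiteHypergraph A B C) => s i)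
      (boltzmannProduct D T).toMeasure ∧
    ∀ i, (boltzmannProduct D T).map (fun s => s i) = boltzmann D (T i) :=
  ⟨tendsto_tvDist_parallelTemperingLaw D T,
    iIndepFun_eval_of_apply_eq_prod (boltzmannProduct_apply D T),
    map_eval_of_apply_eq_prod (boltzmannProduct_apply D T)⟩

theorem mainTheorem5 {A B C : Type*} [Fintype A] [Fintype B] [Fintype C]
    [DecidableEq A] [DecidableEq B] [DecidableEq C] (D : DegreeSequence A B C)
    (n : ℕ) (T : Fin (n + 1) → ℝ) (hpos : ∀ i, 0 < T i) (hmono : StrictMono T) :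
    (∀ μ : PMF (Fin (n + 1) → PartiteHypergraph A B C),
      Tendsto (fun t => tvDist (parallelTemperingLaw D T μ t) (boltzmannProduct D T))
        atTop (𝓝 0)) ∧
    iIndepFun (fun (i : Fin (n + 1)) (s : Fin (n + 1) → PartiteHypergraph A B C) => s i)
      (boltzmannProduct D T).toMeasure ∧
    ∀ i, (boltzmannProduct D T).map (fun s => s i) = boltzmann D (T i) :=
  mainTheorem5_general D n T fun i => (hpos i).ne'
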